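/- For a Hermitian invertible matrix $H\in\mathbb{C}^{n\times n}$, a matrix $X\in\mathbb{C}^{n\times n}$ is called $H$-nonnegative if $x^*HXx\ge 0$ for all $x\in\mathbb{C}^n$. Let $J_k(\mu)$ be the $k\times k$ upper triangular Jordan block with eigenvalue $\mu$, and let $Q_k$ be the $k\times k$ matrix with ones on the main anti-diagonal and zeros elsewhere. Let $B$ be an $H$-nonnegative matrix for which $\sigma(B)\subset[0,\infty)$ and which has no Jordan blocks of size two at the eigenvalue zero (these are the conditions for the existence of an $H$-nonnegative square root), and let $$S^{-1}BS=\bigoplus_{i=1}^{q}J_1(\lambda_i)\oplus\bigoplus_{i=1}^{s}J_1(0),\qquad S^*HS=\bigoplus_{i=1}^{q}Q_1\oplus\bigoplus_{i=1}^{s}\varepsilon_iQ_1\qquad(\lambda_i>0,\ \varepsilon_i=\pm1)$$ be the canonical form of $(B,H)$, with $S$ invertible (in particular, $S=I$ is allowed). A Segre pairing $\mathcal{S}$ of $B$ is a pairing of the Segre characteristic $(1,\dots,1)$ (of length $s$) of $B$ at zero: a collection of pairs $(1,1)$ and $(1,0)$ in which every entry of the Segre characteristic is used exactly once, filled up by zeros.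 Let $\ell_1$ be the number of pairs $(1,0)$ and $\ell_2$ the number of pairs $(1,1)$ in $\mathcal{S}$. After the $s$ blocks $J_1(0)$ of $B$ have been distributed over the entries $1$ of the pairs, let $\zeta_i$ $(1\le i\le\ell_1)$ be the sign $\varepsilon_j$ of the block $J_1(0)$ of $B$ that belongs to the $i$-th pair $(1,0)$. Let $A$ be an $H$-nonnegative matrix with $A^2=B$. Say that $A$ is associated with $\mathcal{S}$ (and the given distribution of blocks) if the part of $S^{-1}AS$ at the blocks $J_1(0)$ of $B$ is the direct sum of $[0]$ for each pair $(1,0)$ and of a nonzero $2\times2$ matrix with square zero for each pair $(1,1)$, each acting on the blocks of its pair. 1. For every $H$-nonnegative square root $A$ of $B$ there are a Segre pairing $\mathcal{S}$ of $B$ and a distribution of the blocks over its pairs such that the two blocks in each pair $(1,1)$ have opposite signs, and the canonical form of $(A,H)$ is $$P^{-1}AP=\bigoplus_{i=1}^{q}J_1(\sqrt{\lambda_i})\oplus\bigoplus_{i=1}^{\ell_1}J_1(0)\oplus\bigoplus_{i=1}^{\ell_2}J_2(0),\qquad P^*HP=\bigoplus_{i=1}^{q}Q_1\oplus\bigoplus_{i=1}^{\ell_1}\zeta_iQ_1\oplus\bigoplus_{i=1}^{\ell_2}Q_2$$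 for some invertible matrix $P$. 2. For every Segre pairing $\mathcal{S}$ of $B$, every distribution of the blocks over its pairs and every $H$-nonnegative square root $A$ of $B$ that is associated with them, the two blocks in each pair $(1,1)$ have opposite signs, and the canonical form of $(A,H)$ is the one displayed in 1, with $\ell_1$, $\ell_2$ and $\zeta_i$ taken from this pairing and distribution. -/

import Mathlib

open Matrix

open scoped ComplexOrder in
/-- `H`-nonnegativity: `[Bx, x] = (HBx, x) ≥ 0` for all `x`, where `(u, v) = v* u` is the Euclidean
product. In the order of `ℂ` used here, `0 ≤ z` says that `z` is real and nonnegative. -/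
def IsHNonneg {n : ℕ} (H B : Matrix (Fin n) (Fin n) ℂ) : Prop :=
  ∀ x : Fin n → ℂ, 0 ≤ star x ⬝ᵥ (H *ᵥ (B *ᵥ x))

/-- The upper triangular Jordan block `J_k(μ)`. -/
def jordanBlock (k : ℕ) (μ : ℂ) : Matrix (Fin k) (Fin k) ℂ :=
  Matrix.of fun i j => if j = i then μ else if (j : ℕ) = (i : ℕ) + 1 then 1 else 0

/-- The sip matrix `Q_k`: ones on the main anti-diagonal and zeros elsewhere. -/
def sipMatrix (k : ℕ) : Matrix (Fin k) (Fin k) ℂ :=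
  Matrix.of fun i j => if (i : ℕ) + (j : ℕ) + 1 = k then 1 else 0

/-- The data of a canonical form with real spectrum: a family of Jordan blocks, each with its
size, its real eigenvalue and its sign. -/
structure SignedBlocks (ι : Type) where
  size : ι → ℕ
  size_pos : ∀ i, 0 < size i
  eig : ι → ℝ
  sign : ι → ℤˣ

namespace SignedBlocks

variable {ι : Type} [DecidableEq ι]

/-- `⨁ᵢ J_{kᵢ}(μᵢ)`. -/
def jordanPart (D : SignedBlocks ι) :
    Matrix (Σ i, Fin (D.size i)) (Σ i, Fin (D.size i)) ℂ :=
  Matrix.blockDiagonal' fun i => jordanBlock (D.size i) (D.eig i : ℂ)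

/-- `⨁ᵢ εᵢ Q_{kᵢ}`. -/
def gramPart (D : SignedBlocks ι) :
    Matrix (Σ i, Fin (D.size i)) (Σ i, Fin (D.size i)) ℂ :=
  Matrix.blockDiagonal' fun i => (((D.sign i : ℤˣ) : ℤ) : ℂ) • sipMatrix (D.size i)

/-- The sizes of the Jordan blocks at the eigenvalue `μ`, as a multiset. -/
noncomputable def segreCharacteristic [Fintype ι] (D : SignedBlocks ι) (μ : ℝ) : Multiset ℕ :=
  (Finset.univ.filter fun i => D.eig i = μ).val.map D.size

end SignedBlocks

/-- `P` brings the pair `(A, H)` to the canonical form `D`: `P` is invertible,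
`P⁻¹ A P = ⨁ᵢ J_{kᵢ}(μᵢ)` and `P* H P = ⨁ᵢ εᵢ Q_{kᵢ}`. The bijection `e` only numbers the rows
and columns of the direct sums by `Fin n`. -/
def IsCanonicalFormVia {n : ℕ} {ι : Type} [DecidableEq ι]
    (P : Matrix (Fin n) (Fin n) ℂ) (A H : Matrix (Fin n) (Fin n) ℂ)
    (D : SignedBlocks ι) (e : Fin n ≃ Σ i, Fin (D.size i)) : Prop :=
  IsUnit P.det ∧ P⁻¹ * A * P = D.jordanPart.submatrix e e ∧
    Pᴴ * H * P = D.gramPart.submatrix e e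

/-- The pair `(A, H)` has canonical form `D`. -/
def HasCanonicalForm {n : ℕ} {ι : Type} [DecidableEq ι]
    (A H : Matrix (Fin n) (Fin n) ℂ) (D : SignedBlocks ι) : Prop :=
  ∃ (e : Fin n ≃ Σ i, Fin (D.size i)) (P : Matrix (Fin n) (Fin n) ℂ), IsCanonicalFormVia P A H D e

/-- The form `⨁_{i ≤ q} J₁(λᵢ) ⊕ ⨁_{i ≤ s} J₁(0)`, `⨁_{i ≤ q} Q₁ ⊕ ⨁_{i ≤ s} εᵢ Q₁`. -/
def semisimpleBlocks {q s : ℕ} (lam : Fin q → ℝ) (eps : Fin s → ℤˣ) :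
    SignedBlocks (Fin q ⊕ Fin s) where
  size := fun _ => 1
  size_pos := fun _ => Nat.one_pos
  eig := Sum.elim lam fun _ => 0
  sign := Sum.elim (fun _ => 1) eps

/-- The form `⨁_{i ≤ q} J₁(√λᵢ) ⊕ ⨁_{i ≤ ℓ₁} J₁(0) ⊕ ⨁_{i ≤ ℓ₂} J₂(0)`,
`⨁_{i ≤ q} Q₁ ⊕ ⨁_{i ≤ ℓ₁} ζᵢ Q₁ ⊕ ⨁_{i ≤ ℓ₂} Q₂`. -/
noncomputable def rootBlocks {q l₁ : ℕ} (lam : Fin q → ℝ) (zeta : Fin l₁ → ℤˣ) (l₂ : ℕ) :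
    SignedBlocks (Fin q ⊕ Fin l₁ ⊕ Fin l₂) where
  size := Sum.elim (fun _ => 1) (Sum.elim (fun _ => 1) fun _ => 2)
  size_pos := by rintro (i | i | i) <;> simp
  eig := Sum.elim (fun i => Real.sqrt (lam i)) fun _ => 0
  sign := Sum.elim (fun _ => 1) (Sum.elim zeta fun _ => 1)

/-- A Segre pairing of a Segre characteristic `N` (a multiset of positive integers). The
lexicographic arrangement of the pairs makes it a multiset of pairs. -/
structure IsSegrePairing (N : Multiset ℕ) (S : Multiset (ℕ × ℕ)) : Prop where
  /-- every entry of `N` appears in exactly one pair; the remaining entries are zeros -/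
  cover : (S.map Prod.fst + S.map Prod.snd).filter (fun m => 0 < m) = N
  /-- every pair contains an entry of `N` -/
  fst_pos : ∀ p ∈ S, 0 < p.1
  snd_le_fst : ∀ p ∈ S, p.2 ≤ p.1
  diff_le_one : ∀ p ∈ S, p.1 - p.2 ≤ 1

/-- The number of pairs `(1, 0)`. -/
def numOneZero (S : Multiset (ℕ × ℕ)) : ℕ := S.count (1, 0)

/-- The number of pairs `(1, 1)`. -/
def numOneOne (S : Multiset (ℕ × ℕ)) : ℕ := S.count (1, 1)

/-- A distribution of the `s` blocks `J₁(0)` over the pairs of a Segre pairing: the block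
`f (inl i)` belongs to the `i`-th pair `(1, 0)`, and the blocks `f (inr (0, j))`,
`f (inr (1, j))` belong to the `j`-th pair `(1, 1)`. -/
abbrev BlockAssignment (s : ℕ) (S : Multiset (ℕ × ℕ)) : Type :=
  Fin (numOneZero S) ⊕ (Fin 2 × Fin (numOneOne S)) ≃ Fin s

/-- The square root `A₀` of the `s × s` zero matrix `⨁_{i ≤ s} J₁(0)` is associated with a Segre
pairing whose pairs are filled with blocks according to `f`: it is the direct sum of the square
root `[0]` of `J₁(0)` for each pair `(1, 0)` and of a nonzero square root `R j` of
`J₁(0) ⊕ J₁(0)` for each pair `(1, 1)`. -/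
def IsAssociatedRoot {s : ℕ} {S : Multiset (ℕ × ℕ)} (f : BlockAssignment s S)
    (A₀ : Matrix (Fin s) (Fin s) ℂ) : Prop :=
  ∃ R : Fin (numOneOne S) → Matrix (Fin 2) (Fin 2) ℂ,
    (∀ j, R j * R j = 0 ∧ R j ≠ 0) ∧
    A₀.submatrix f f = Matrix.fromBlocks 0 0 0 (Matrix.blockDiagonal R)

/-- The part of a matrix that belongs to the zero eigenvalue blocks of `semisimpleBlocks`. -/
def zeroPart {n q s : ℕ} (lam : Fin q → ℝ) (eps : Fin s → ℤˣ)
    (e : Fin n ≃ Σ i, Fin ((semisimpleBlocks lam eps).size i))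
    (M : Matrix (Fin n) (Fin n) ℂ) : Matrix (Fin s) (Fin s) ℂ :=
  M.submatrix (fun i => e.symm ⟨Sum.inr i, (0 : Fin 1)⟩)
    (fun i => e.symm ⟨Sum.inr i, (0 : Fin 1)⟩)

/-!
In the canonical basis of `(B, H)` the form is `1 ⊕ E`, with `E` the signature matrix of the signs
`εᵢ` at the eigenvalue zero. A root `A` commutes with `A² = B`, so it is block diagonal in this basis
(`root_eq_fromBlocks`). On the positive spectrum of `B` the form is definite, and `A` is the positive
semidefinite square root `⨁ √λᵢ`. On the kernel of `B` it is a matrix `A₀` with `A₀² = 0` and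
`K = E A₀` positive semidefinite.

Let the columns of `V` be orthonormal eigenvectors of `K` for its positive eigenvalues `d_j`. From
`K E K = E A₀² = 0` they span an `E`-neutral subspace, so `v_j` and `E v_j` together are orthonormal,
and `√d_j E v_j`, `v_j / √d_j` is a Jordan chain of `A₀` with Gram matrix `Q₂`. Neutrality also says
that on the coordinates of sign `+1`, and on those of sign `-1`, the restrictions of `√2 v_j` are
orthonormal. Hence the number of chains is at most the number of signs of either kind, so that
pairs of opposite signs can be formed; and extending these restrictions to orthonormal bases of the
two sign classes (`exists_unitary_commuting_signMatrix`) gives eigenvectors of `E`, annihilated by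
`A₀`, whose signs are precisely those of the unpaired blocks. So the signs in the canonical form of
`A` come out for every pairing of opposite signs with `rank A₀` pairs
(`exists_canonical_basis_of_neutral`), without an appeal to the law of inertia.

For an associated root, each `2 × 2` block is nonzero, has square zero, and is nonnegative. Equal
signs would make it Hermitian up to sign, thus zero; so its signs are opposite, its rank is one, and
the eigenvectors of the blocks are the required `V` (`exists_decomposition_of_isAssociatedRoot`).
-/

/-! ### Signature matrices and neutral subspaces -/

/-- The signature matrix `⨁ᵢ εᵢ Q₁` of a family of signs. -/
def signMatrix {ι : Type*} [DecidableEq ι] (eps : ι → ℤˣ) : Matrix ι ι ℂ :=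
  diagonal fun i => ((eps i : ℤ) : ℂ)

theorem sign_mul_sign (u : ℤˣ) : ((u : ℤ) : ℂ) * ((u : ℤ) : ℂ) = 1 := by
  rcases Int.units_eq_one_or u with rfl | rfl <;> simp

theorem signMatrix_mul_self {ι : Type*} [Fintype ι] [DecidableEq ι] (eps : ι → ℤˣ) :
    signMatrix eps * signMatrix eps = 1 := by
  rw [signMatrix, diagonal_mul_diagonal]
  simp only [sign_mul_sign, diagonal_one]

theorem signMatrix_conjTranspose {ι : Type*} [DecidableEq ι] (eps : ι → ℤˣ) :
    (signMatrix eps)ᴴ = signMatrix eps := by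
  rw [signMatrix, diagonal_conjTranspose]
  congr 1
  ext i
  simp

open scoped ComplexOrder in
/-- The reduced spectral decomposition of a positive semidefinite matrix: its zero eigenvalues are
left out, so that the columns of `V` are as many as the rank. -/
theorem Matrix.PosSemidef.exists_reduced_spectral_decomposition {m : Type*} [Fintype m]
    [DecidableEq m] {K : Matrix m m ℂ} (hK : K.PosSemidef) {r : ℕ} (hr : K.rank = r) :
    ∃ (V : Matrix m (Fin r) ℂ) (d : Fin r → ℝ), (∀ j, 0 < d j) ∧ Vᴴ * V = 1 ∧
      K = V * diagonal (fun j => (d j : ℂ)) * Vᴴ := by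
  classical
  subst hr
  have hcard := hK.1.rank_eq_card_non_zero_eigs
  let t : Fin K.rank ≃ {i // hK.1.eigenvalues i ≠ 0} :=
    (finCongr hcard).trans (Fintype.equivFin _).symm
  let U : Matrix m m ℂ := hK.1.eigenvectorUnitary
  have hU : Uᴴ * U = 1 := (Matrix.mem_unitaryGroup_iff').1 hK.1.eigenvectorUnitary.2
  refine ⟨U.submatrix id fun j => t j, fun j => hK.1.eigenvalues (t j), fun j => ?_, ?_, ?_⟩
  · exact lt_of_le_of_ne (hK.eigenvalues_nonneg _) (t j).2.symm
  · calc _ = (Uᴴ * U).submatrix (fun j => (t j : m)) (fun j => (t j : m)) := rfl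
      _ = 1 := by rw [hU]; exact submatrix_one _ (Subtype.val_injective.comp t.injective)
  · have hs : K = U * diagonal (fun i => (hK.1.eigenvalues i : ℂ)) * Uᴴ := by
      have := hK.1.spectral_theorem
      rwa [Unitary.conjStarAlgAut_apply] at this
    conv_lhs => rw [hs]
    ext a b
    rw [mul_apply, mul_apply]
    simp only [mul_diagonal, submatrix_apply, conjTranspose_apply, id]
    rw [t.sum_comp (fun i : {i // hK.1.eigenvalues i ≠ 0} =>
      U a i * (hK.1.eigenvalues i : ℂ) * star (U b i))]
    rw [← Finset.sum_subtype (Finset.univ.filter fun i => hK.1.eigenvalues i ≠ 0) (by simp)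
      (fun i => U a i * (hK.1.eigenvalues i : ℂ) * star (U b i))]
    refine (Finset.sum_filter_of_ne (p := fun i => hK.1.eigenvalues i ≠ 0)
      fun i _ hi h0 => hi ?_).symm
    simp [h0]

/-- If `K = V D V*` with orthonormal columns of `V` and `D > 0`, then `K E K = 0` makes the columns
of `V` span an `E`-neutral subspace. -/
theorem neutral_of_mul_mul_eq_zero {m r : Type*} [Fintype m] [Fintype r] [DecidableEq r]
    {V : Matrix m r ℂ} {d : r → ℝ} (hd : ∀ j, 0 < d j) (hV : Vᴴ * V = 1) {E : Matrix m m ℂ}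
    (h : V * diagonal (fun j => (d j : ℂ)) * Vᴴ * E * (V * diagonal (fun j => (d j : ℂ)) * Vᴴ) = 0) :
    Vᴴ * E * V = 0 := by
  have h1 : diagonal (fun j => (d j : ℂ)) * (Vᴴ * E * V) * diagonal (fun j => (d j : ℂ)) = 0 := by
    calc _ = (Vᴴ * V) * diagonal (fun j => (d j : ℂ)) * (Vᴴ * E * V) *
          diagonal (fun j => (d j : ℂ)) * (Vᴴ * V) := by rw [hV]; simp
      _ = Vᴴ * (V * diagonal (fun j => (d j : ℂ)) * Vᴴ * E *
          (V * diagonal (fun j => (d j : ℂ)) * Vᴴ)) * V := by simp only [Matrix.mul_assoc]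
      _ = 0 := by rw [h]; simp
  ext i j
  have h2 := congrFun (congrFun h1 i) j
  rw [mul_diagonal, diagonal_mul] at h2
  have hi : (d i : ℂ) ≠ 0 := by exact_mod_cast (hd i).ne'
  have hj : (d j : ℂ) ≠ 0 := by exact_mod_cast (hd j).ne'
  simpa [hi, hj] using h2

/-- The columns of `V` are orthonormal and span a neutral subspace of the signature matrix: then
their parts on the coordinates of either sign are orthogonal, with squared norm `1 / 2`. -/
theorem sum_sign_class_of_neutral {s : ℕ} {r : Type*} [DecidableEq r] {eps : Fin s → ℤˣ}
    {V : Matrix (Fin s) r ℂ} (hV : Vᴴ * V = 1) (hVE : Vᴴ * signMatrix eps * V = 0)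
    (u : ℤˣ) (j k : r) :
    ∑ a : {a // eps a = u}, star (V a j) * V a k = if j = k then 1 / 2 else 0 := by
  have h1 := congrFun (congrFun hV j) k
  have h2 := congrFun (congrFun hVE j) k
  rw [mul_apply] at h1 h2
  simp only [signMatrix, mul_diagonal, conjTranspose_apply, Matrix.zero_apply, one_apply] at h1 h2
  -- the indicator of the sign class of `u` is `(1 + u ε) / 2`
  have h3 : ∑ a : {a // eps a = u}, star (V a j) * V a k =
      ∑ a, (star (V a j) * V a k +
        ((u : ℤ) : ℂ) * (star (V a j) * ((eps a : ℤ) : ℂ) * V a k)) / 2 := by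
    rw [← Finset.sum_subtype (Finset.univ.filter fun a => eps a = u) (by simp)
      (fun a => star (V a j) * V a k), Finset.sum_filter]
    refine Finset.sum_congr rfl fun a _ => ?_
    rcases Int.units_eq_one_or u with rfl | rfl <;>
      rcases Int.units_eq_one_or (eps a) with h | h <;> simp [h]
  rw [h3, ← Finset.sum_div, Finset.sum_add_distrib, ← Finset.mul_sum, h1, h2]
  split_ifs <;> simp

open scoped ComplexOrder in
/-- Over `ℂ`, nonnegativity of the quadratic form already makes the matrix Hermitian. -/
theorem IsHNonneg.posSemidef {n : ℕ} {H A : Matrix (Fin n) (Fin n) ℂ} (h : IsHNonneg H A) :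
    (H * A).PosSemidef := by
  rw [← Matrix.isPositive_toEuclideanLin_iff, LinearMap.isPositive_iff_complex]
  intro x
  have h1 := h x.ofLp
  rw [mulVec_mulVec] at h1
  have h2 : inner ℂ ((H * A).toEuclideanLin x) x = star (star x.ofLp ⬝ᵥ ((H * A) *ᵥ x.ofLp)) := by
    rw [EuclideanSpace.inner_eq_star_dotProduct, star_dotProduct, star_star, dotProduct_comm]
    simp
  rw [h2]
  obtain ⟨hr, hi⟩ := Complex.nonneg_iff.1 h1
  refine ⟨Complex.ext rfl ?_, hr⟩
  simp [← hi]

/-! ### Canonical bases of square roots of zero -/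

/-- Orthonormal columns spanning a neutral subspace of the signature matrix extend to a unitary
matrix that commutes with the signature matrix: on each sign class the rescaled restrictions
`√2 V` are orthonormal, and they are extended there. Which columns of the unitary matrix carry them
is prescribed by `f`, provided that each pair of columns carries both signs. -/
theorem exists_unitary_commuting_signMatrix {s : ℕ} {κ r : Type*} [DecidableEq r]
    {eps : Fin s → ℤˣ} (f : κ ⊕ (Fin 2 × r) ≃ Fin s)
    (hf : ∀ j, eps (f (Sum.inr (1, j))) = -eps (f (Sum.inr (0, j))))
    {V : Matrix (Fin s) r ℂ} (hV : Vᴴ * V = 1) (hVE : Vᴴ * signMatrix eps * V = 0) :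
    ∃ N : Matrix (Fin s) (Fin s) ℂ, Nᴴ * N = 1 ∧ signMatrix eps * N = N * signMatrix eps ∧
      ∀ a k j, N a (f (Sum.inr (k, j))) =
        if eps a = eps (f (Sum.inr (k, j))) then (√2 : ℂ) * V a j else 0 := by
  let v (u : ℤˣ) (i : {a // eps a = u}) : EuclideanSpace ℂ {a // eps a = u} :=
    WithLp.toLp 2 fun a => Sum.elim (fun _ => 0) (fun p => (√2 : ℂ) * V a p.2) (f.symm i)
  let T (u : ℤˣ) : Set {a // eps a = u} := {i | ∃ p, f (Sum.inr p) = i}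
  have hv (u : ℤˣ) : Orthonormal ℂ ((T u).domRestrict (v u)) := by
    rw [orthonormal_iff_ite]
    rintro ⟨⟨a, hi⟩, hT⟩ ⟨⟨a', hi'⟩, hT'⟩
    obtain ⟨⟨k, j⟩, ha⟩ := id hT
    obtain ⟨⟨k', j'⟩, ha'⟩ := id hT'
    change f _ = a at ha
    change f _ = a' at ha'
    subst ha ha'
    have h1 := sum_sign_class_of_neutral hV hVE u j j'
    -- in a pair of columns with opposite signs only one belongs to the sign class
    have h2 : j = j' → k = k' := by
      rintro rfl
      have hne : ∀ w : ℤˣ, -w ≠ w := by decide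
      fin_cases k <;> fin_cases k'
      · rfl
      · exact absurd ((hf j).symm.trans (hi'.trans hi.symm)) (hne _)
      · exact absurd ((hf j).symm.trans (hi.trans hi'.symm)) (hne _)
      · rfl
    have h3 : (√2 : ℂ) * (√2 : ℂ) = 2 := by
      rw [← Complex.ofReal_mul, Real.mul_self_sqrt (by norm_num)]; norm_num
    calc _ = 2 * ∑ a : {a // eps a = u}, star (V a j) * V a j' := by
          rw [Finset.mul_sum]
          simp only [Set.domRestrict_apply, PiLp.inner_apply, v, Equiv.symm_apply_apply, Sum.elim_inr]
          refine Finset.sum_congr rfl fun a _ => ?_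
          simp only [RCLike.inner_apply, map_mul, Complex.conj_ofReal, ← h3]
          rw [starRingEnd_apply]
          ring
      _ = _ := by
          rw [h1]
          by_cases hj : j = j'
          · obtain rfl := h2 hj
            subst hj
            simp
          · simp [hj]
  have hb (u : ℤˣ) := (hv u).exists_orthonormalBasis_extension_of_card_eq (by simp)
  choose b hb using hb
  let M (u : ℤˣ) : Matrix {a // eps a = u} {a // eps a = u} ℂ := of fun a i => b u i a
  have hM (u : ℤˣ) : (M u)ᴴ * M u = 1 := by
    ext i j
    have := orthonormal_iff_ite.1 (b u).orthonormal i j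
    rw [PiLp.inner_apply] at this
    rw [mul_apply, one_apply, ← this]
    refine Finset.sum_congr rfl fun a _ => ?_
    simp [M, RCLike.inner_apply, mul_comm]
  let e : Fin s ≃ Σ u, {a // eps a = u} := (Equiv.sigmaFiberEquiv eps).symm
  have happ (a : Fin s) (u : ℤˣ) (h : eps a = u) (i : {a // eps a = u}) :
      blockDiagonal' M (e a) ⟨u, i⟩ = M u ⟨a, h⟩ i := by
    subst h
    exact blockDiagonal'_apply_eq M _ _ _
  refine ⟨(blockDiagonal' M).submatrix e e, ?_, ?_, ?_⟩
  · rw [conjTranspose_submatrix, submatrix_mul_equiv, blockDiagonal'_conjTranspose,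
      ← blockDiagonal'_mul]
    simp only [hM]
    rw [show (fun u => (1 : Matrix {a // eps a = u} {a // eps a = u} ℂ)) = 1 from rfl,
      blockDiagonal'_one, submatrix_one_equiv]
  · ext a i
    rw [signMatrix, diagonal_mul, mul_diagonal, submatrix_apply]
    by_cases h : eps a = eps i
    · rw [h, mul_comm]
    · rw [show blockDiagonal' M (e a) (e i) = 0 from blockDiagonal'_apply_ne M _ _ h]
      simp
  · intro a k j
    rw [submatrix_apply]
    split_ifs with h
    · have := happ a _ h ⟨f (Sum.inr (k, j)), rfl⟩
      refine this.trans ?_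
      have h4 := hb _ ⟨f (Sum.inr (k, j)), rfl⟩ ⟨(k, j), rfl⟩
      simp only [M, of_apply, h4, v, Equiv.symm_apply_apply, Sum.elim_inr]
    · exact blockDiagonal'_apply_ne M _ _ h

theorem ite_add_ite_of_eq_neg {u w w' : ℤˣ} (h : w' = -w) (x : ℂ) :
    (if u = w then x else 0) + (if u = w' then x else 0) = x := by
  rcases Int.units_eq_one_or u with rfl | rfl <;>
    rcases Int.units_eq_one_or w with rfl | rfl <;> simp [h]

/-- The complement of the space spanned by a neutral orthonormal family and its image under the
signature matrix has an orthonormal basis of eigenvectors of the signature matrix, whose signs are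
the ones that remain when pairs of opposite signs are removed. -/
theorem exists_sign_eigenvectors_of_neutral {s : ℕ} {κ r : Type*} [DecidableEq κ] [DecidableEq r]
    [Fintype κ]
    {eps : Fin s → ℤˣ} (f : κ ⊕ (Fin 2 × r) ≃ Fin s)
    (hf : ∀ j, eps (f (Sum.inr (1, j))) = -eps (f (Sum.inr (0, j))))
    {V : Matrix (Fin s) r ℂ} (hV : Vᴴ * V = 1) (hVE : Vᴴ * signMatrix eps * V = 0) :
    ∃ X : Matrix (Fin s) κ ℂ, Xᴴ * X = 1 ∧ Xᴴ * V = 0 ∧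
      signMatrix eps * X = X * signMatrix fun i => eps (f (Sum.inl i)) := by
  obtain ⟨N, hN, hE, hcol⟩ := exists_unitary_commuting_signMatrix f hf hV hVE
  refine ⟨N.submatrix id fun i => f (Sum.inl i), ?_, ?_, ?_⟩
  · calc _ = (Nᴴ * N).submatrix (fun i => f (Sum.inl i)) (fun i => f (Sum.inl i)) := rfl
      _ = 1 := by rw [hN]; exact submatrix_one _ (f.injective.comp Sum.inl_injective)
  · -- `√2` times a column of `V` is the sum of two columns of `N`
    have hVN (a j) : (√2 : ℂ) * V a j = N a (f (Sum.inr (0, j))) + N a (f (Sum.inr (1, j))) := by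
      rw [hcol, hcol, ite_add_ite_of_eq_neg (hf j)]
    ext i j
    have h1 : (√2 : ℂ) * ((N.submatrix id fun i => f (Sum.inl i))ᴴ * V) i j =
        (Nᴴ * N) (f (Sum.inl i)) (f (Sum.inr (0, j))) +
          (Nᴴ * N) (f (Sum.inl i)) (f (Sum.inr (1, j))) := by
      simp only [mul_apply, Finset.mul_sum, ← Finset.sum_add_distrib]
      refine Finset.sum_congr rfl fun a _ => ?_
      rw [mul_left_comm, hVN, mul_add]
      rfl
    rw [hN, one_apply_ne (by simp), one_apply_ne (by simp), add_zero] at h1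
    simpa using h1
  · ext a i
    have := congrFun (congrFun hE a) (f (Sum.inl i))
    rw [signMatrix, diagonal_mul, mul_diagonal] at this
    rw [signMatrix, signMatrix, diagonal_mul, mul_diagonal]
    exact this

/-- The eigenvectors of `E A` at its positive eigenvalues span an `E`-neutral subspace if `E` is a
signature matrix and `A` squares to zero. -/
theorem neutral_of_root {s : ℕ} {r : Type*} [DecidableEq r] [Fintype r]
    {eps : Fin s → ℤˣ} {V : Matrix (Fin s) r ℂ} {d : r → ℝ} (hd : ∀ j, 0 < d j) (hV : Vᴴ * V = 1)
    {A : Matrix (Fin s) (Fin s) ℂ}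
    (hA : signMatrix eps * A = V * diagonal (fun j => (d j : ℂ)) * Vᴴ) (hA2 : A * A = 0) :
    Vᴴ * signMatrix eps * V = 0 := by
  refine neutral_of_mul_mul_eq_zero hd hV ?_
  rw [← hA]
  set E := signMatrix eps with hE
  calc E * A * E * (E * A) = E * (A * (E * E) * A) := by simp only [Matrix.mul_assoc]
    _ = 0 := by rw [hE, signMatrix_mul_self, Matrix.mul_one, hA2, Matrix.mul_zero]

/-- The canonical basis of a square root of zero. With `E` the signature matrix, the Jordan chains
are `E v, v`, suitably scaled, for the eigenvectors `v` of `E A` at its positive eigenvalues. -/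
theorem exists_canonical_basis_of_neutral {s : ℕ} {κ r : Type*} [DecidableEq κ] [DecidableEq r]
    [Fintype κ] [Fintype r]
    {eps : Fin s → ℤˣ} (f : κ ⊕ (Fin 2 × r) ≃ Fin s)
    (hf : ∀ j, eps (f (Sum.inr (1, j))) = -eps (f (Sum.inr (0, j))))
    {V : Matrix (Fin s) r ℂ} (hV : Vᴴ * V = 1) {d : r → ℝ} (hd : ∀ j, 0 < d j)
    {A : Matrix (Fin s) (Fin s) ℂ}
    (hA : signMatrix eps * A = V * diagonal (fun j => (d j : ℂ)) * Vᴴ) (hA2 : A * A = 0) :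
    ∃ X : Matrix (Fin s) (κ ⊕ (r ⊕ r)) ℂ,
      A * X = X * (fromBlocks 0 0 0 (fromBlocks 0 1 0 0) : Matrix (κ ⊕ (r ⊕ r)) (κ ⊕ (r ⊕ r)) ℂ) ∧
      Xᴴ * signMatrix eps * X =
        fromBlocks (signMatrix fun i => eps (f (Sum.inl i))) 0 0 (fromBlocks 0 1 1 0) := by
  set E := signMatrix eps with hEdef
  have hEE : E * E = 1 := signMatrix_mul_self eps
  have hEH : Eᴴ = E := signMatrix_conjTranspose eps
  set D : Matrix r r ℂ := diagonal fun j => (d j : ℂ) with hD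
  set C : Matrix r r ℂ := diagonal fun j => (√(d j) : ℂ) with hC
  set C' : Matrix r r ℂ := diagonal fun j => ((√(d j))⁻¹ : ℂ) with hC'
  have hCC : C * C = D := by
    rw [hC, diagonal_mul_diagonal, hD]
    congr 1; ext j
    rw [← Complex.ofReal_mul, Real.mul_self_sqrt (hd j).le]
  have hCC' : C * C' = 1 := by
    rw [hC, hC', diagonal_mul_diagonal, ← diagonal_one]
    congr 1; ext j
    exact mul_inv_cancel₀ (by exact_mod_cast (Real.sqrt_pos.2 (hd j)).ne')
  have hCH : Cᴴ = C := by
    rw [hC, diagonal_conjTranspose]; congr 1; ext j; simp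
  have hCH' : C'ᴴ = C' := by
    rw [hC', diagonal_conjTranspose]; congr 1; ext j; simp
  have hC'C : C' * C = 1 := mul_eq_one_comm.1 hCC'
  have hA' : A = E * (V * D * Vᴴ) := by
    rw [← hA, ← Matrix.mul_assoc, hEE, Matrix.one_mul]
  have hVE : Vᴴ * E * V = 0 := neutral_of_root hd hV hA hA2
  obtain ⟨X, hX, hXV, hXE⟩ := exists_sign_eigenvectors_of_neutral f hf hV hVE
  set Z := signMatrix fun i => eps (f (Sum.inl i)) with hZ
  have hVX : Vᴴ * X = 0 := by
    rw [← conjTranspose_conjTranspose X, ← conjTranspose_mul, hXV, conjTranspose_zero]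
  have hXE' : Xᴴ * E = Z * Xᴴ := by
    have := congrArg conjTranspose hXE
    rwa [conjTranspose_mul, conjTranspose_mul, ← hEdef, hEH, hZ, signMatrix_conjTranspose] at this
  refine ⟨fromCols X (fromCols (E * V * C) (V * C')), ?_, ?_⟩
  · have h1 : A * X = 0 := by
      rw [hA', Matrix.mul_assoc, Matrix.mul_assoc, hVX, Matrix.mul_zero, Matrix.mul_zero]
    have h2 : A * (E * V * C) = 0 := by
      calc _ = E * V * D * (Vᴴ * E * V) * C := by rw [hA']; simp only [Matrix.mul_assoc]
        _ = 0 := by rw [hVE]; simp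
    have h3 : A * (V * C') = E * V * C := by
      calc _ = E * V * D * (Vᴴ * V) * C' := by rw [hA']; simp only [Matrix.mul_assoc]
        _ = E * V * C * (C * C') := by
          rw [hV, ← hCC]; simp only [Matrix.mul_assoc, Matrix.one_mul]
        _ = _ := by rw [hCC', Matrix.mul_one]
    rw [mul_fromCols, mul_fromCols, fromCols_mul_fromBlocks, fromCols_mul_fromBlocks, h1, h2, h3]
    simp
  · have h11 : Xᴴ * E * X = Z := by rw [hXE', Matrix.mul_assoc, hX, Matrix.mul_one]
    have h12 : Xᴴ * E * (E * V * C) = 0 := by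
      calc _ = Xᴴ * (E * E) * V * C := by simp only [Matrix.mul_assoc]
        _ = 0 := by rw [hEE, Matrix.mul_one, hXV, Matrix.zero_mul]
    have h13 : Xᴴ * E * (V * C') = 0 := by
      rw [hXE', Matrix.mul_assoc, ← Matrix.mul_assoc Xᴴ, hXV]; simp
    have h21 : (E * V * C)ᴴ * E * X = 0 := by
      have := congrArg conjTranspose h12
      simpa only [conjTranspose_mul, conjTranspose_conjTranspose, hEH, Matrix.mul_assoc,
        conjTranspose_zero] using this
    have h31 : (V * C')ᴴ * E * X = 0 := by
      have := congrArg conjTranspose h13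
      simpa only [conjTranspose_mul, conjTranspose_conjTranspose, hEH, Matrix.mul_assoc,
        conjTranspose_zero] using this
    have h22 : (E * V * C)ᴴ * E * (E * V * C) = 0 := by
      calc _ = C * (Vᴴ * (E * (E * E)) * V) * C := by
            simp only [conjTranspose_mul, hEH, hCH, Matrix.mul_assoc]
        _ = 0 := by rw [hEE, Matrix.mul_one, hVE]; simp
    have h23 : (E * V * C)ᴴ * E * (V * C') = 1 := by
      calc _ = C * (Vᴴ * (E * E) * V) * C' := by
            simp only [conjTranspose_mul, hEH, hCH, Matrix.mul_assoc]
        _ = 1 := by rw [hEE, Matrix.mul_one, hV, Matrix.mul_one, hCC']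
    have h32 : (V * C')ᴴ * E * (E * V * C) = 1 := by
      calc _ = C' * (Vᴴ * (E * E) * V) * C := by
            simp only [conjTranspose_mul, hCH', Matrix.mul_assoc]
        _ = 1 := by rw [hEE, Matrix.mul_one, hV, Matrix.mul_one, hC'C]
    have h33 : (V * C')ᴴ * E * (V * C') = 0 := by
      calc _ = C' * (Vᴴ * E * V) * C' := by
            simp only [conjTranspose_mul, hCH', Matrix.mul_assoc]
        _ = 0 := by rw [hVE]; simp
    simp only [conjTranspose_fromCols_eq_fromRows_conjTranspose, fromRows_mul, mul_fromCols,
      h11, h12, h13, h21, h22, h23, h31, h32, h33]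
    ext (i | i | i) (j | j | j) <;> rfl

/-! ### Pairs of opposite signs -/

/-- The dimension of a neutral subspace is at most the number of signs of either kind. -/
theorem card_le_card_sign_class_of_neutral {s : ℕ} {r : Type*} [Fintype r] [DecidableEq r]
    {eps : Fin s → ℤˣ} {V : Matrix (Fin s) r ℂ} (hV : Vᴴ * V = 1)
    (hVE : Vᴴ * signMatrix eps * V = 0) (u : ℤˣ) :
    Fintype.card r ≤ Fintype.card {a // eps a = u} := by
  let W : Matrix {a // eps a = u} r ℂ := V.submatrix Subtype.val id
  have hW : ((2 : ℂ) • Wᴴ) * W = 1 := by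
    ext j k
    have := sum_sign_class_of_neutral hV hVE u j k
    rw [Matrix.smul_mul, Matrix.smul_apply, mul_apply, one_apply]
    change (2 : ℂ) • ∑ a : {a // eps a = u}, star (V a j) * V a k = _
    rw [this]
    split_ifs <;> simp
  calc Fintype.card r = (((2 : ℂ) • Wᴴ) * W).rank := by rw [hW, rank_one]
    _ ≤ W.rank := rank_mul_le_right _ _
    _ ≤ _ := rank_le_card_height _

/-- Signs can be paired off, as long as there are enough of either kind. -/
theorem exists_equiv_pairing_opposite_signs {s l₁ l₂ : ℕ} (eps : Fin s → ℤˣ) (hs : l₁ + 2 * l₂ = s)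
    (h : ∀ u, l₂ ≤ Fintype.card {a // eps a = u}) :
    ∃ f : Fin l₁ ⊕ (Fin 2 × Fin l₂) ≃ Fin s,
      ∀ j, eps (f (Sum.inr (1, j))) = -eps (f (Sum.inr (0, j))) := by
  have hc (u : ℤˣ) : Nonempty (Fin l₂ ↪ {a // eps a = u}) :=
    Function.Embedding.nonempty_of_card_le (by simpa using h u)
  let c (u : ℤˣ) : Fin l₂ ↪ {a // eps a = u} := (hc u).some
  let w : Fin 2 → ℤˣ := ![1, -1]
  have hw : Function.Injective w := by decide
  let p : Fin 2 × Fin l₂ → Fin s := fun x => c (w x.1) x.2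
  have hp : Function.Injective p := by
    rintro ⟨k, j⟩ ⟨k', j'⟩ hx
    have hk : k = k' := hw <| by
      rw [← (c (w k) j).2, ← (c (w k') j').2]
      exact congrArg eps hx
    subst hk
    exact Prod.ext rfl ((c (w k)).injective (Subtype.ext hx))
  classical
  have hcard : Fintype.card ((Set.range p)ᶜ : Set (Fin s)) = Fintype.card (Fin l₁) := by
    rw [Fintype.card_compl_set, Set.card_range_of_injective hp]
    simp
    omega
  refine ⟨(((Fintype.equivOfCardEq hcard).symm.sumCongr (Equiv.ofInjective p hp)).trans
    (Equiv.sumComm _ _)).trans (Equiv.Set.sumCompl (Set.range p)), fun j => ?_⟩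
  have h0 : eps (p (0, j)) = 1 := (c 1 j).2
  have h1 : eps (p (1, j)) = -1 := (c (-1) j).2
  simp [h0, h1]

open scoped ComplexOrder in
/-- A nonzero square root of the `2 × 2` zero matrix can only be nonnegative for a form with
opposite signs: for equal signs it would be Hermitian. Since it has rank one, it comes from a single
eigenvector. -/
theorem opposite_signs_of_mul_self_eq_zero {w : Fin 2 → ℤˣ} {R : Matrix (Fin 2) (Fin 2) ℂ}
    (hR2 : R * R = 0) (hR : R ≠ 0) (hK : (signMatrix w * R).PosSemidef) :
    w 1 = -w 0 ∧ ∃ (V : Matrix (Fin 2) (Fin 1) ℂ) (d : Fin 1 → ℝ), (∀ j, 0 < d j) ∧ Vᴴ * V = 1 ∧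
      signMatrix w * R = V * diagonal (fun j => (d j : ℂ)) * Vᴴ := by
  have hRK : R = signMatrix w * (signMatrix w * R) := by
    rw [← Matrix.mul_assoc, signMatrix_mul_self, Matrix.one_mul]
  have hK0 : signMatrix w * R ≠ 0 := fun h => hR (by rw [hRK, h, Matrix.mul_zero])
  constructor
  · by_contra hne
    have hw : ∀ k, w k = w 0 := by
      intro k
      fin_cases k
      · rfl
      · exact (by decide : ∀ a b : ℤˣ, ¬a = -b → a = b) _ _ hne
    have hsm : signMatrix w = (((w 0 : ℤ) : ℂ)) • (1 : Matrix (Fin 2) (Fin 2) ℂ) := by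
      rw [signMatrix, smul_one_eq_diagonal]
      simp only [hw]
    apply hK0
    rw [← conjTranspose_mul_self_eq_zero, hK.1.eq, hsm, Matrix.smul_mul, Matrix.one_mul,
      Matrix.smul_mul, Matrix.mul_smul, hR2]
    simp
  · apply hK.exists_reduced_spectral_decomposition
    have h1 := rank_add_rank_le_card_of_mul_eq_zero hR2
    have h2 := rank_mul_le_right (signMatrix w) R
    have h3 : (signMatrix w * R).rank ≠ 0 := by
      intro h0
      obtain ⟨V, d, -, -, h⟩ := hK.exists_reduced_spectral_decomposition h0
      apply hK0
      rw [h]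
      ext i j
      simp [mul_apply]
    rw [Fintype.card_fin] at h1
    omega

open scoped ComplexOrder in
/-- The reduced spectral decomposition of a root that is a direct sum of nonzero `2 × 2` blocks has
one eigenvector for each of these blocks. -/
theorem exists_decomposition_of_isAssociatedRoot {s : ℕ} {S : Multiset (ℕ × ℕ)}
    {f : BlockAssignment s S} {A : Matrix (Fin s) (Fin s) ℂ} {eps : Fin s → ℤˣ}
    (hA : IsAssociatedRoot f A) (hK : (signMatrix eps * A).PosSemidef) :
    (∀ j, eps (f (Sum.inr (1, j))) = -eps (f (Sum.inr (0, j)))) ∧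
      ∃ (V : Matrix (Fin s) (Fin (numOneOne S)) ℂ) (d : Fin (numOneOne S) → ℝ), (∀ j, 0 < d j) ∧
        Vᴴ * V = 1 ∧ signMatrix eps * A = V * diagonal (fun j => (d j : ℂ)) * Vᴴ := by
  obtain ⟨R, hR, hAR⟩ := hA
  have hentry (x y) : (signMatrix eps * A) (f x) (f y) =
      ((eps (f x) : ℤ) : ℂ) * fromBlocks 0 0 0 (blockDiagonal R) x y := by
    rw [← hAR, signMatrix, diagonal_mul, submatrix_apply]
  have hblock (j) := opposite_signs_of_mul_self_eq_zero (w := fun k => eps (f (Sum.inr (k, j))))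
    (hR j).1 (hR j).2 <| by
      convert hK.submatrix fun k => f (Sum.inr (k, j)) using 1
      ext k k'
      rw [submatrix_apply, hentry, signMatrix, diagonal_mul, fromBlocks_apply₂₂,
        blockDiagonal_apply_eq]
  refine ⟨fun j => (hblock j).1, ?_⟩
  choose V d hd hV hVd using fun j => (hblock j).2
  refine ⟨of fun a j => Sum.elim (fun _ => 0) (fun p => if p.2 = j then V j p.1 0 else 0) (f.symm a),
    fun j => d j 0, fun j => hd j 0, ?_, ?_⟩
  · ext i j
    have h1 := congrFun (congrFun (hV i) 0) 0
    rw [mul_apply, one_apply_eq] at h1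
    rw [mul_apply, ← f.sum_comp, Fintype.sum_sum_type, Fintype.sum_prod_type]
    simp only [conjTranspose_apply, of_apply, Equiv.symm_apply_apply, Sum.elim_inl, Sum.elim_inr,
      mul_zero, Finset.sum_const_zero, zero_add, one_apply]
    split_ifs with hij
    · subst hij
      simpa using h1
    · refine Finset.sum_eq_zero fun k _ => Finset.sum_eq_zero fun l _ => ?_
      split_ifs with h2 h3 <;> simp_all
  · ext a b
    obtain ⟨x, rfl⟩ := f.surjective a
    obtain ⟨y, rfl⟩ := f.surjective b
    rw [hentry, mul_apply]
    simp only [conjTranspose_apply, of_apply, Equiv.symm_apply_apply, mul_diagonal]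
    rcases x with i | ⟨k, j⟩ <;> rcases y with i' | ⟨k', j'⟩
    · simp
    · simp
    · simp
    · have h1 := congrFun (congrFun (hVd j) k) k'
      rw [signMatrix, diagonal_mul, mul_apply] at h1
      simp only [Fin.sum_univ_one, mul_diagonal, conjTranspose_apply] at h1
      simp only [fromBlocks_apply₂₂, blockDiagonal_apply, Sum.elim_inr]
      by_cases hj : j = j'
      · subst hj
        simp [h1]
      · simp only [if_neg hj, mul_zero]
        refine (Finset.sum_eq_zero fun l _ => ?_).symm
        split_ifs with h2 h3 <;> simp_all

/-! ### Direct sums of Jordan blocks -/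

theorem sipMatrix_mul_self (k : ℕ) : sipMatrix k * sipMatrix k = 1 := by
  ext i j
  rw [mul_apply, Finset.sum_eq_single (Fin.rev i), one_apply]
  · have : (i : ℕ) + (Fin.rev i : ℕ) + 1 = k := by rw [Fin.val_rev]; omega
    simp only [sipMatrix, of_apply, if_pos this, one_mul, Fin.ext_iff]
    congr 1
    rw [eq_iff_iff]
    omega
  · intro b _ hb
    have : ¬ (i : ℕ) + (b : ℕ) + 1 = k := fun h => hb (by rw [Fin.ext_iff, Fin.val_rev]; omega)
    simp only [sipMatrix, of_apply, if_neg this, zero_mul]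
  · simp

theorem SignedBlocks.gramPart_mul_self {ι : Type} [Fintype ι] [DecidableEq ι]
    (D : SignedBlocks ι) : D.gramPart * D.gramPart = 1 := by
  rw [gramPart, ← blockDiagonal'_mul, ← blockDiagonal'_one]
  congr 1
  ext1 i
  rw [Matrix.smul_mul, Matrix.mul_smul, smul_smul, sign_mul_sign, one_smul, sipMatrix_mul_self]
  rfl

namespace SignedBlocks

variable {ι : Type} [DecidableEq ι] (D : SignedBlocks ι)

theorem jordanPart_apply_eq (i : ι) (k l : Fin (D.size i)) :
    D.jordanPart ⟨i, k⟩ ⟨i, l⟩ = jordanBlock (D.size i) (D.eig i : ℂ) k l :=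
  blockDiagonal'_apply_eq _ _ _ _

theorem jordanPart_apply_ne {x y : Σ i, Fin (D.size i)} (h : x.1 ≠ y.1) : D.jordanPart x y = 0 :=
  blockDiagonal'_apply_ne _ _ _ h

theorem gramPart_apply_eq (i : ι) (k l : Fin (D.size i)) :
    D.gramPart ⟨i, k⟩ ⟨i, l⟩ = ((D.sign i : ℤ) : ℂ) * sipMatrix (D.size i) k l :=
  blockDiagonal'_apply_eq _ _ _ _

theorem gramPart_apply_ne {x y : Σ i, Fin (D.size i)} (h : x.1 ≠ y.1) : D.gramPart x y = 0 :=
  blockDiagonal'_apply_ne _ _ _ h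

end SignedBlocks

/-- A canonical basis may be numbered by any copy `τ` of the rows of the canonical form, and its
independence is automatic since the Gram matrix `⨁ εᵢ Q_{kᵢ}` is invertible. -/
theorem hasCanonicalForm_of_basis {n : ℕ} {ι τ : Type} [Fintype ι] [DecidableEq ι] [Fintype τ]
    [DecidableEq τ] {A H : Matrix (Fin n) (Fin n) ℂ} {D : SignedBlocks ι}
    (h : τ ≃ Σ i, Fin (D.size i)) (hn : Fintype.card τ = n) (X : Matrix (Fin n) τ ℂ)
    (hA : A * X = X * D.jordanPart.submatrix h h) (hH : Xᴴ * H * X = D.gramPart.submatrix h h) :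
    HasCanonicalForm A H D := by
  let e : Fin n ≃ τ := (Fintype.equivFinOfCardEq hn).symm
  let P : Matrix (Fin n) (Fin n) ℂ := X.submatrix id e
  have h1 : Pᴴ * H * P = D.gramPart.submatrix (e.trans h) (e.trans h) := by
    calc _ = (Xᴴ * H * X).submatrix e e := rfl
      _ = _ := by rw [hH]; rfl
  have h2 : A * P = P * D.jordanPart.submatrix (e.trans h) (e.trans h) := by
    calc _ = (A * X).submatrix id e := rfl
      _ = P * (D.jordanPart.submatrix h h).submatrix e e := by
        rw [hA]; exact (submatrix_mul_equiv _ _ _ _ _).symm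
  have h3 : IsUnit P.det := by
    rw [← isUnit_iff_isUnit_det]
    refine IsUnit.of_mul_eq_one (D.gramPart.submatrix (e.trans h) (e.trans h) * (Pᴴ * H)) ?_
    apply mul_eq_one_comm.1
    rw [Matrix.mul_assoc, h1, submatrix_mul_equiv, D.gramPart_mul_self, submatrix_one_equiv]
  refine ⟨e.trans h, P, h3, ?_, h1⟩
  rw [Matrix.mul_assoc, h2, ← Matrix.mul_assoc, nonsing_inv_mul _ h3, Matrix.one_mul]

section Blocks

variable {q s l₁ : ℕ} (lam : Fin q → ℝ)

/-- The rows of the canonical form `rootBlocks`, where the first rows of the blocks of size two are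
put together, and so are their second rows. -/
def rootBlocksEquiv (zeta : Fin l₁ → ℤˣ) (l₂ : ℕ) :
    Fin q ⊕ (Fin l₁ ⊕ (Fin l₂ ⊕ Fin l₂)) ≃ Σ i, Fin ((rootBlocks lam zeta l₂).size i) where
  toFun
    | Sum.inl i => ⟨Sum.inl i, (0 : Fin 1)⟩
    | Sum.inr (Sum.inl i) => ⟨Sum.inr (Sum.inl i), (0 : Fin 1)⟩
    | Sum.inr (Sum.inr (Sum.inl i)) => ⟨Sum.inr (Sum.inr i), (0 : Fin 2)⟩
    | Sum.inr (Sum.inr (Sum.inr i)) => ⟨Sum.inr (Sum.inr i), (1 : Fin 2)⟩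
  invFun
    | ⟨Sum.inl i, _⟩ => Sum.inl i
    | ⟨Sum.inr (Sum.inl i), _⟩ => Sum.inr (Sum.inl i)
    | ⟨Sum.inr (Sum.inr i), k⟩ =>
      if (k : ℕ) = 0 then Sum.inr (Sum.inr (Sum.inl i)) else Sum.inr (Sum.inr (Sum.inr i))
  left_inv := by rintro (i | i | i | i) <;> rfl
  right_inv := by
    rintro ⟨i | i | i, k⟩
    · change Fin 1 at k
      fin_cases k; rfl
    · change Fin 1 at k
      fin_cases k; rfl
    · change Fin 2 at k
      fin_cases k <;> rfl

theorem rootBlocks_jordanPart (zeta : Fin l₁ → ℤˣ) (l₂ : ℕ) :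
    (rootBlocks lam zeta l₂).jordanPart.submatrix (rootBlocksEquiv lam zeta l₂)
      (rootBlocksEquiv lam zeta l₂) =
      fromBlocks (diagonal fun i => (√(lam i) : ℂ)) 0 0 (fromBlocks 0 0 0 (fromBlocks 0 1 0 0)) := by
  ext (i | i | i | i) (j | j | j | j)
  all_goals rw [submatrix_apply]
  all_goals
    first
    | exact SignedBlocks.jordanPart_apply_ne _ Sum.inl_ne_inr
    | exact SignedBlocks.jordanPart_apply_ne _ Sum.inr_ne_inl
    | exact SignedBlocks.jordanPart_apply_ne _ (Sum.inr_injective.ne Sum.inl_ne_inr)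
    | exact SignedBlocks.jordanPart_apply_ne _ (Sum.inr_injective.ne Sum.inr_ne_inl)
    | skip
  all_goals
    rcases eq_or_ne i j with rfl | h
    · refine (SignedBlocks.jordanPart_apply_eq _ _ _ _).trans ?_
      simp [rootBlocks, jordanBlock]
      rfl
    · refine (SignedBlocks.jordanPart_apply_ne _ ?_).trans ?_
      · simpa [rootBlocksEquiv] using h
      · simp [h]

theorem rootBlocks_gramPart (zeta : Fin l₁ → ℤˣ) (l₂ : ℕ) :
    (rootBlocks lam zeta l₂).gramPart.submatrix (rootBlocksEquiv lam zeta l₂)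
      (rootBlocksEquiv lam zeta l₂) =
      fromBlocks 1 0 0 (fromBlocks (signMatrix zeta) 0 0 (fromBlocks 0 1 1 0)) := by
  ext (i | i | i | i) (j | j | j | j)
  all_goals rw [submatrix_apply]
  all_goals
    first
    | exact SignedBlocks.gramPart_apply_ne _ Sum.inl_ne_inr
    | exact SignedBlocks.gramPart_apply_ne _ Sum.inr_ne_inl
    | exact SignedBlocks.gramPart_apply_ne _ (Sum.inr_injective.ne Sum.inl_ne_inr)
    | exact SignedBlocks.gramPart_apply_ne _ (Sum.inr_injective.ne Sum.inr_ne_inl)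
    | skip
  all_goals
    rcases eq_or_ne i j with rfl | h
    · refine (SignedBlocks.gramPart_apply_eq _ _ _ _).trans ?_
      simp [rootBlocks, sipMatrix, signMatrix]
      rfl
    · refine (SignedBlocks.gramPart_apply_ne _ ?_).trans ?_
      · simpa [rootBlocksEquiv] using h
      · simp [h, signMatrix]

/-- The rows of the canonical form `semisimpleBlocks`. -/
def semisimpleBlocksEquiv (eps : Fin s → ℤˣ) :
    Fin q ⊕ Fin s ≃ Σ i, Fin ((semisimpleBlocks lam eps).size i) where
  toFun i := ⟨i, (0 : Fin 1)⟩
  invFun x := x.1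
  left_inv _ := rfl
  right_inv := by
    rintro ⟨i, k⟩
    change Fin 1 at k
    fin_cases k; rfl

theorem semisimpleBlocks_jordanPart (eps : Fin s → ℤˣ) :
    (semisimpleBlocks lam eps).jordanPart.submatrix (semisimpleBlocksEquiv lam eps)
      (semisimpleBlocksEquiv lam eps) = diagonal (Sum.elim (fun i => (lam i : ℂ)) fun _ => 0) := by
  ext i j
  by_cases h : i = j
  · subst h
    refine (SignedBlocks.jordanPart_apply_eq _ _ _ _).trans ?_
    rcases i with i | i <;> simp [semisimpleBlocks, jordanBlock] <;> rfl
  · exact (SignedBlocks.jordanPart_apply_ne _ h).trans (diagonal_apply_ne _ h).symm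

theorem semisimpleBlocks_gramPart (eps : Fin s → ℤˣ) :
    (semisimpleBlocks lam eps).gramPart.submatrix (semisimpleBlocksEquiv lam eps)
      (semisimpleBlocksEquiv lam eps) = signMatrix (Sum.elim (fun _ => 1) eps) := by
  ext i j
  by_cases h : i = j
  · subst h
    refine (SignedBlocks.gramPart_apply_eq _ _ _ _).trans ?_
    rcases i with i | i <;> simp [semisimpleBlocks, sipMatrix, signMatrix]
    · exact (mul_one _).trans Int.cast_one
    · exact mul_one _
  · exact (SignedBlocks.gramPart_apply_ne _ h).trans (diagonal_apply_ne _ h).symm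

end Blocks

/-! ### Block structure of the root -/

open scoped ComplexOrder in
/-- A positive semidefinite square root of a positive diagonal matrix. -/
theorem Matrix.PosSemidef.eq_diagonal_sqrt {m : Type*} [Fintype m] [DecidableEq m]
    {A : Matrix m m ℂ} (hA : A.PosSemidef) {lam : m → ℝ} (hlam : ∀ i, 0 < lam i)
    (h : A * A = diagonal fun i => (lam i : ℂ)) : A = diagonal fun i => (√(lam i) : ℂ) := by
  set C : Matrix m m ℂ := diagonal fun i => (√(lam i) : ℂ) with hC
  have hCC : C * C = A * A := by
    rw [h, hC, diagonal_mul_diagonal]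
    congr 1; ext j
    rw [← Complex.ofReal_mul, Real.mul_self_sqrt (hlam j).le]
  -- `A` commutes with its square, hence with every function of this diagonal matrix
  have hcomm : A * C = C * A := by
    ext i j
    have h1 : (A * (A * A)) i j = ((A * A) * A) i j := by rw [Matrix.mul_assoc]
    rw [h, mul_diagonal, diagonal_mul, mul_comm] at h1
    rw [hC, mul_diagonal, diagonal_mul]
    by_cases hij : A i j = 0
    · simp [hij]
    · have h2 := mul_right_cancel₀ hij h1
      rw [Complex.ofReal_inj] at h2
      rw [h2, mul_comm]
  have hCpos : C.PosDef := PosDef.diagonal fun i => by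
    exact_mod_cast Real.sqrt_pos.2 (hlam i)
  have hu : IsUnit (C + A) := (hCpos.add_posSemidef hA).isUnit
  have h3 : (C + A) * (A - C) = (C + A) * 0 := by
    rw [Matrix.mul_zero, Matrix.add_mul, Matrix.mul_sub, Matrix.mul_sub, hCC, hcomm]
    abel
  exact sub_eq_zero.1 (hu.mul_left_cancel h3)

open scoped ComplexOrder in
/-- A square root commutes with its square `⨁ λᵢ ⊕ 0`, so it is block diagonal; on the first block
the form is definite and the root is the positive one. -/
theorem root_eq_fromBlocks {q s : ℕ} {lam : Fin q → ℝ} (hlam : ∀ i, 0 < lam i) {eps : Fin s → ℤˣ}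
    {A : Matrix (Fin q ⊕ Fin s) (Fin q ⊕ Fin s) ℂ}
    (hA : A * A = diagonal (Sum.elim (fun i => (lam i : ℂ)) fun _ => 0))
    (hK : (signMatrix (Sum.elim (fun _ => 1) eps) * A).PosSemidef) :
    A = fromBlocks (diagonal fun i => (√(lam i) : ℂ)) 0 0 A.toBlocks₂₂ ∧
      A.toBlocks₂₂ * A.toBlocks₂₂ = 0 ∧ (signMatrix eps * A.toBlocks₂₂).PosSemidef := by
  have hcomm (i j) : A i j * Sum.elim (fun i => (lam i : ℂ)) (fun _ => 0) j =
      Sum.elim (fun i => (lam i : ℂ)) (fun _ => 0) i * A i j := by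
    rw [← mul_diagonal, ← diagonal_mul, ← hA, Matrix.mul_assoc]
  have hl (i) : (lam i : ℂ) ≠ 0 := by exact_mod_cast (hlam i).ne'
  have h12 : A.toBlocks₁₂ = 0 := by
    ext i j
    have := (hcomm (Sum.inl i) (Sum.inr j)).symm
    simpa [hl, toBlocks₁₂] using this
  have h21 : A.toBlocks₂₁ = 0 := by
    ext i j
    have := hcomm (Sum.inr i) (Sum.inl j)
    simpa [hl, toBlocks₂₁] using this
  have hAb : A = fromBlocks A.toBlocks₁₁ 0 0 A.toBlocks₂₂ := by
    conv_lhs => rw [← fromBlocks_toBlocks A, h12, h21]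
  have hAA := hA
  rw [hAb, fromBlocks_multiply, ← fromBlocks_diagonal (fun i => (lam i : ℂ)) (fun _ : Fin s => 0),
    fromBlocks_inj] at hAA
  obtain ⟨h11, -, -, h22⟩ := hAA
  simp only [Matrix.mul_zero, add_zero, zero_add] at h11 h22
  have hK1 : A.toBlocks₁₁.PosSemidef := by
    convert hK.submatrix Sum.inl using 1
    ext i j
    simp [signMatrix, diagonal_mul, toBlocks₁₁]
  have hK2 : (signMatrix eps * A.toBlocks₂₂).PosSemidef := by
    convert hK.submatrix Sum.inr using 1
    ext i j
    simp [signMatrix, diagonal_mul, toBlocks₂₂]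
  refine ⟨?_, ?_, hK2⟩
  · rw [← hK1.eq_diagonal_sqrt hlam h11]
    exact hAb
  · rw [h22]
    exact diagonal_zero

/-! ### Segre pairings of `(1, …, 1)` -/

theorem semisimpleBlocks_segreCharacteristic_zero {q s : ℕ} {lam : Fin q → ℝ}
    (hlam : ∀ i, 0 < lam i) (eps : Fin s → ℤˣ) :
    (semisimpleBlocks lam eps).segreCharacteristic 0 = Multiset.replicate s 1 := by
  have hf : (Finset.univ.filter fun i => (semisimpleBlocks lam eps).eig i = 0) =
      Finset.univ.map (Function.Embedding.inr : Fin s ↪ Fin q ⊕ Fin s) := by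
    ext (i | i)
    · have : (semisimpleBlocks lam eps).eig (Sum.inl i) = lam i := rfl
      simp [this, (hlam i).ne']
    · have : (semisimpleBlocks lam eps).eig (Sum.inr i) = 0 := rfl
      simp [this]
  rw [SignedBlocks.segreCharacteristic, hf]
  exact (Multiset.map_const' _ _).trans (by simp)

theorem isSegrePairing_replicate (l₁ l₂ : ℕ) :
    IsSegrePairing (Multiset.replicate (l₁ + 2 * l₂) 1)
      (Multiset.replicate l₁ (1, 0) + Multiset.replicate l₂ (1, 1)) where
  cover := by
    have h0 : (Multiset.replicate l₁ 0).filter (fun m => 0 < m) = 0 :=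
      Multiset.filter_eq_nil.2 fun a ha => by simp [Multiset.eq_of_mem_replicate ha]
    have h1 (l : ℕ) : (Multiset.replicate l 1).filter (fun m => 0 < m) = Multiset.replicate l 1 :=
      Multiset.filter_eq_self.2 fun a ha => by simp [Multiset.eq_of_mem_replicate ha]
    simp only [Multiset.map_add, Multiset.map_replicate, Multiset.filter_add, h0, h1, zero_add,
      ← Multiset.replicate_add]
    congr 1
    omega
  fst_pos p hp := by
    rcases Multiset.mem_add.1 hp with h | h <;> simp [Multiset.eq_of_mem_replicate h]
  snd_le_fst p hp := by
    rcases Multiset.mem_add.1 hp with h | h <;> simp [Multiset.eq_of_mem_replicate h]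
  diff_le_one p hp := by
    rcases Multiset.mem_add.1 hp with h | h <;> simp [Multiset.eq_of_mem_replicate h]

theorem numOneZero_replicate (l₁ l₂ : ℕ) :
    numOneZero (Multiset.replicate l₁ (1, 0) + Multiset.replicate l₂ (1, 1)) = l₁ := by
  simp [numOneZero, Multiset.count_replicate]

theorem numOneOne_replicate (l₁ l₂ : ℕ) :
    numOneOne (Multiset.replicate l₁ (1, 0) + Multiset.replicate l₂ (1, 1)) = l₂ := by
  simp [numOneOne, Multiset.count_replicate]

/-! ### Nonnegative square roots in the canonical basis -/

section Reduction

variable {n q s : ℕ} {A B H S : Matrix (Fin n) (Fin n) ℂ} {lam : Fin q → ℝ} {eps : Fin s → ℤˣ}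
  {e : Fin n ≃ Σ i, Fin ((semisimpleBlocks lam eps).size i)}

open scoped ComplexOrder in
/-- In the canonical basis of `(B, H)`, a nonnegative square root of `B` is `⨁ √λᵢ` on the positive
spectrum of `B`; the remaining part is nonnegative for the signature matrix and squares to zero. -/
theorem root_in_canonical_basis (hlam : ∀ i, 0 < lam i)
    (hBH : IsCanonicalFormVia S B H (semisimpleBlocks lam eps) e) (hA : IsHNonneg H A)
    (hAB : A * A = B) :
    let g := (semisimpleBlocksEquiv lam eps).trans e.symm
    let A₀ := zeroPart lam eps e (S⁻¹ * A * S)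
    (S⁻¹ * A * S).submatrix g g = fromBlocks (diagonal fun i => (√(lam i) : ℂ)) 0 0 A₀ ∧
      A₀ * A₀ = 0 ∧ (signMatrix eps * A₀).PosSemidef := by
  intro g A₀
  obtain ⟨hS, hSB, hSH⟩ := hBH
  have hSS : S * S⁻¹ = 1 := mul_nonsing_inv S hS
  refine root_eq_fromBlocks hlam (A := (S⁻¹ * A * S).submatrix g g) ?_ ?_
  · rw [submatrix_mul_equiv]
    have : S⁻¹ * A * S * (S⁻¹ * A * S) = S⁻¹ * B * S := by
      calc _ = S⁻¹ * A * (S * S⁻¹) * A * S := by simp only [Matrix.mul_assoc]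
        _ = _ := by rw [hSS, Matrix.mul_one, Matrix.mul_assoc S⁻¹ A A, hAB]
    rw [this, hSB, ← semisimpleBlocks_jordanPart lam eps]
    ext i j
    simp [g]
  · have hG : signMatrix (Sum.elim (fun _ => 1) eps) = (Sᴴ * H * S).submatrix g g := by
      rw [hSH, ← semisimpleBlocks_gramPart lam eps]
      ext i j
      simp [g]
    rw [hG, submatrix_mul_equiv]
    have : Sᴴ * H * S * (S⁻¹ * A * S) = Sᴴ * (H * A) * S := by
      calc _ = Sᴴ * H * (S * S⁻¹) * A * S := by simp only [Matrix.mul_assoc]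
        _ = _ := by rw [hSS, Matrix.mul_one]; simp only [Matrix.mul_assoc]
    rw [this]
    exact (hA.posSemidef.conjTranspose_mul_mul_same S).submatrix g

/-- The canonical form of a nonnegative square root is known once the part at the eigenvalue zero is
diagonalized with as many positive eigenvalues as there are pairs of blocks. -/
theorem hasCanonicalForm_root (hlam : ∀ i, 0 < lam i)
    (hBH : IsCanonicalFormVia S B H (semisimpleBlocks lam eps) e) (hA : IsHNonneg H A)
    (hAB : A * A = B) {l₁ l₂ : ℕ} (f : Fin l₁ ⊕ (Fin 2 × Fin l₂) ≃ Fin s)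
    (hf : ∀ j, eps (f (Sum.inr (1, j))) = -eps (f (Sum.inr (0, j))))
    {V : Matrix (Fin s) (Fin l₂) ℂ} (hV : Vᴴ * V = 1) {d : Fin l₂ → ℝ} (hd : ∀ j, 0 < d j)
    (hVd : signMatrix eps * zeroPart lam eps e (S⁻¹ * A * S) =
      V * diagonal (fun j => (d j : ℂ)) * Vᴴ) :
    HasCanonicalForm A H (rootBlocks lam (fun i => eps (f (Sum.inl i))) l₂) := by
  obtain ⟨hroot, hA2, -⟩ := root_in_canonical_basis hlam hBH hA hAB
  obtain ⟨X, hAX, hGX⟩ := exists_canonical_basis_of_neutral f hf hV hd hVd hA2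
  obtain ⟨hS, hSB, hSH⟩ := hBH
  set g := (semisimpleBlocksEquiv lam eps).trans e.symm
  let T : Matrix (Fin n) (Fin q ⊕ Fin s) ℂ := S.submatrix id g
  have hAT : A * T = T * (S⁻¹ * A * S).submatrix g g := by
    calc _ = (A * S).submatrix id g := rfl
      _ = (S * (S⁻¹ * A * S)).submatrix id g := by
        rw [← Matrix.mul_assoc, ← Matrix.mul_assoc, mul_nonsing_inv S hS, Matrix.one_mul]
      _ = _ := (submatrix_mul_equiv _ _ _ _ _).symm
  have hHT : Tᴴ * H * T = fromBlocks 1 0 0 (signMatrix eps) := by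
    calc _ = (Sᴴ * H * S).submatrix g g := rfl
      _ = signMatrix (Sum.elim (fun _ => 1) eps) := by
        rw [hSH, ← semisimpleBlocks_gramPart lam eps]
        ext i j
        simp [g]
      _ = _ := by
        ext (i | i) (j | j) <;> simp [signMatrix, diagonal_apply, one_apply]
  let Y : Matrix (Fin q ⊕ Fin s) (Fin q ⊕ (Fin l₁ ⊕ (Fin l₂ ⊕ Fin l₂))) ℂ := fromBlocks 1 0 0 X
  refine hasCanonicalForm_of_basis (rootBlocksEquiv lam _ l₂) ?_ (T * Y) ?_ ?_
  · have h1 := Fintype.card_congr g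
    have h2 := Fintype.card_congr f
    simp only [Fintype.card_sum, Fintype.card_prod, Fintype.card_fin] at h1 h2 ⊢
    omega
  · rw [hroot] at hAT
    rw [← Matrix.mul_assoc, hAT, Matrix.mul_assoc T, Matrix.mul_assoc T, rootBlocks_jordanPart,
      fromBlocks_multiply, fromBlocks_multiply, hAX]
    simp
  · have : (T * Y)ᴴ * H * (T * Y) = Yᴴ * (Tᴴ * H * T) * Y := by
      rw [conjTranspose_mul]
      simp only [Matrix.mul_assoc]
    rw [this, hHT, rootBlocks_gramPart, fromBlocks_conjTranspose, fromBlocks_multiply,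
      fromBlocks_multiply, ← hGX]
    simp

end Reduction

theorem mainTheorem8 {n q s : ℕ} (B H : Matrix (Fin n) (Fin n) ℂ)
    (hH : H.IsHermitian) (hHdet : IsUnit H.det) (hB : IsHNonneg H B)
    (lam : Fin q → ℝ) (hlam : ∀ i, 0 < lam i) (eps : Fin s → ℤˣ)
    (e : Fin n ≃ Σ i, Fin ((semisimpleBlocks lam eps).size i))
    (S : Matrix (Fin n) (Fin n) ℂ)
    (hBH : IsCanonicalFormVia S B H (semisimpleBlocks lam eps) e) :
    (∀ A : Matrix (Fin n) (Fin n) ℂ, IsHNonneg H A → A * A = B →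
      ∃ 𝒮 : Multiset (ℕ × ℕ),
        IsSegrePairing ((semisimpleBlocks lam eps).segreCharacteristic 0) 𝒮 ∧
        ∃ f : BlockAssignment s 𝒮,
          (∀ j, eps (f (Sum.inr (1, j))) = -eps (f (Sum.inr (0, j)))) ∧
          HasCanonicalForm A H
            (rootBlocks lam (fun i => eps (f (Sum.inl i))) (numOneOne 𝒮))) ∧
    (∀ (𝒮 : Multiset (ℕ × ℕ)),
      IsSegrePairing ((semisimpleBlocks lam eps).segreCharacteristic 0) 𝒮 →
      ∀ (f : BlockAssignment s 𝒮) (A : Matrix (Fin n) (Fin n) ℂ),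
        IsHNonneg H A → A * A = B →
        IsAssociatedRoot f (zeroPart lam eps e (S⁻¹ * A * S)) →
          (∀ j, eps (f (Sum.inr (1, j))) = -eps (f (Sum.inr (0, j)))) ∧
          HasCanonicalForm A H
            (rootBlocks lam (fun i => eps (f (Sum.inl i))) (numOneOne 𝒮))) := by
  refine ⟨fun A hA hAB => ?_, fun 𝒮 _ f A hA hAB hf => ?_⟩
  · obtain ⟨-, hA2, hK⟩ := root_in_canonical_basis hlam hBH hA hAB
    obtain ⟨r, hrank⟩ : ∃ r, (signMatrix eps * zeroPart lam eps e (S⁻¹ * A * S)).rank = r :=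
      ⟨_, rfl⟩
    obtain ⟨V, d, hd, hV, hVd⟩ := hK.exists_reduced_spectral_decomposition hrank
    have hVE : Vᴴ * signMatrix eps * V = 0 := neutral_of_root hd hV hVd hA2
    have hr (u : ℤˣ) : r ≤ Fintype.card {a // eps a = u} := by
      simpa using card_le_card_sign_class_of_neutral hV hVE u
    -- the two sign classes are disjoint
    have hrs : 2 * r ≤ s := by
      have h := Fintype.card_congr (Equiv.sigmaFiberEquiv eps)
      rw [Fintype.card_sigma, Fintype.card_fin, UnitsInt.univ, Finset.sum_pair (by decide)] at h
      have := hr 1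
      have := hr (-1)
      omega
    obtain ⟨l, hl⟩ : ∃ l, l + 2 * r = s := ⟨s - 2 * r, by omega⟩
    refine ⟨Multiset.replicate l (1, 0) + Multiset.replicate r (1, 1), ?_, ?_⟩
    · rw [semisimpleBlocks_segreCharacteristic_zero hlam, ← hl]
      exact isSegrePairing_replicate l r
    · obtain ⟨f, hf⟩ := exists_equiv_pairing_opposite_signs eps hl hr
      have key (l' r' : ℕ) (hl' : l' = l) (hr' : r' = r) :
          ∃ f : Fin l' ⊕ (Fin 2 × Fin r') ≃ Fin s,
            (∀ j, eps (f (Sum.inr (1, j))) = -eps (f (Sum.inr (0, j)))) ∧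
              HasCanonicalForm A H (rootBlocks lam (fun i => eps (f (Sum.inl i))) r') := by
        subst hl' hr'
        exact ⟨f, hf, hasCanonicalForm_root hlam hBH hA hAB f hf hV hd hVd⟩
      exact key _ _ (numOneZero_replicate l r) (numOneOne_replicate l r)
  · obtain ⟨-, -, hK⟩ := root_in_canonical_basis hlam hBH hA hAB
    obtain ⟨hsign, V, d, hd, hV, hVd⟩ := exists_decomposition_of_isAssociatedRoot hf hK
    exact ⟨hsign, hasCanonicalForm_root hlam hBH hA hAB f hsign hV hd hVd⟩
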